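/- **Conventions.** All diagrams are small. A *sketch* $\mathcal S=(\mathcal S,\mathsf L,\mathsf C)$ is a locally small category $\mathcal S$ with a class $\mathsf L$ of cones and a class $\mathsf C$ of cocones in $\mathcal S$; it is *small* if $\mathcal S$ is essentially small. A morphism of sketches is a functor sending each cone in $\mathsf L$ (cocone in $\mathsf C$) to one naturally isomorphic to a specified one; 2-cells are all natural transformations. This gives the 2-category $\mathsf{skt}$ of small sketches. For a small sketch let $\hat{\mathcal S}\subseteq\mathrm{Psh}(\mathcal S)=[\mathcal S^{op},\mathsf{Set}]$ be the full subcategory of presheaves orthogonal to the comparison maps $\operatorname{colim}(y d)\to y s$, one for each cocone $d\Rightarrow s$ in $\mathsf C$, and let $J=L\circ y:\mathcal S\to\hat{\mathcal S}$, where $y$ is the Yoneda embedding and $L$ is the reflector, i.e. the left adjoint of the inclusion (only its values on representables are needed). $\mathcal S$ is *rounded* if $L$ is defined on the representables and $J$ sends every cone in $\mathsf L$ to a limit cone; $r\mathsf{skt}\subseteq\mathsf{skt}$ is the full sub-2-category of rounded sketches. A *class of lex-weights* $\Phi$ is a class of functors $\varphi:\mathcal K^{op}\to\mathsf{Set}$,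 each $\mathcal K$ small and finitely complete. For $D:\mathcal K\to\mathcal C$ preserving finite limits, the $\varphi$-weighted colimit of $D$ is the colimit of $\mathrm{El}(\varphi)\to\mathcal K\xrightarrow{D}\mathcal C$; colimits of this form with $\varphi\in\Phi$ are the *$\Phi$-lex-colimits*. An essentially small, finitely complete category $\mathcal C$ is *$\Phi$-exact* if its embedding in $\Phi_l\mathcal C$ has a left adjoint preserving finite limits, where $\Phi_l\mathcal C\subseteq\mathrm{Psh}(\mathcal C)$ is the smallest replete full subcategory containing the representables and closed under finite limits and $\Phi$-lex-colimits. $\Phi\text{-}\mathsf{ex}$ is the 2-category of $\Phi$-exact categories, functors preserving finite limits and $\Phi$-lex-colimits, and natural transformations. Let $I_\Phi:\Phi\text{-}\mathsf{ex}\to\mathsf{skt}$ be the 2-functor which sends $\mathcal C$ to the sketch on $\mathcal C$ whose specified cones are all finite limit cones and whose specified cocones are all colimit cocones under diagrams $\mathrm{El}(\varphi)\to\mathcal K\xrightarrow{D}\mathcal C$ with $\varphi\in\Phi$ and $D$ preserving finite limits, and which is the identity on underlying functors and natural transformations. **Proposition.** For every class $\Phi$ of lex-weights, the 2-functor $I_\Phi:\Phi\text{-}\mathsf{ex}\to\mathsf{skt}$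 factors through the inclusion $r\mathsf{skt}\hookrightarrow\mathsf{skt}$. Moreover, for each $\Phi$-exact $\mathcal C$, the sketch remains rounded if all small limit cones are specified instead of only the finite ones; and if $\Phi$ is a set, then the inclusion $\widehat{I_\Phi\mathcal C}\subseteq\mathrm{Psh}(\mathcal C)$ has a left adjoint $L$ defined on all presheaves. -/

import Mathlib

open CategoryTheory CategoryTheory.Limits Opposite
open CategoryTheory.Bicategory (InducedBicategory)

universe v u

set_option linter.checkUnivs false

/-! ### Sketches -/

/-- A small diagram `diagram : J ⥤ C` together with a cone over it. -/
structure DiagramCone (C : Type v) [Category.{u} C] : Type (max v (u + 1)) where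
  J : Type u
  [cat : SmallCategory J]
  diagram : J ⥤ C
  cone : Cone diagram

/-- A small diagram `diagram : J ⥤ C` together with a cocone under it. -/
structure DiagramCocone (C : Type v) [Category.{u} C] : Type (max v (u + 1)) where
  J : Type u
  [cat : SmallCategory J]
  diagram : J ⥤ C
  cocone : Cocone diagram

attribute [instance] DiagramCone.cat DiagramCocone.cat

/-- A sketch: a (locally small) category with a class of specified cones and a class of
specified cocones, over small diagrams. -/
structure Sketch : Type (max (v + 1) (u + 2)) where
  carrier : Type v
  [cat : Category.{u} carrier]
  cones : Set (DiagramCone carrier)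
  cocones : Set (DiagramCocone carrier)

attribute [instance] Sketch.cat

/-- `F` sends every cone of the class `A` to a cone naturally isomorphic to one of the class
`B`: the diagrams are naturally isomorphic, compatibly with an isomorphism of the apices. -/
def PreservesConeClass {C D : Type v} [Category.{u} C] [Category.{u} D] (F : C ⥤ D)
    (A : Set (DiagramCone C)) (B : Set (DiagramCone D)) : Prop :=
  ∀ (J : Type u) [SmallCategory J] (d : J ⥤ C) (c : Cone d), DiagramCone.mk J d c ∈ A →
    ∃ (d' : J ⥤ D) (c' : Cone d') (e : d ⋙ F ≅ d'), DiagramCone.mk J d' c' ∈ B ∧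
      Nonempty ((Cone.postcompose e.hom).obj (F.mapCone c) ≅ c')

/-- `F` sends every cocone of the class `A` to a cocone naturally isomorphic to one of `B`. -/
def PreservesCoconeClass {C D : Type v} [Category.{u} C] [Category.{u} D] (F : C ⥤ D)
    (A : Set (DiagramCocone C)) (B : Set (DiagramCocone D)) : Prop :=
  ∀ (J : Type u) [SmallCategory J] (d : J ⥤ C) (c : Cocone d), DiagramCocone.mk J d c ∈ A →
    ∃ (d' : J ⥤ D) (c' : Cocone d') (e : d' ≅ d ⋙ F), DiagramCocone.mk J d' c' ∈ B ∧
      Nonempty ((Cocone.precompose e.hom).obj (F.mapCocone c) ≅ c')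

section
variable {C D E : Type v} [Category.{u} C] [Category.{u} D] [Category.{u} E]

/-- The isomorphism of apices underlying an isomorphism of cones. -/
def coneApexIso {J : Type u} [SmallCategory J] {d : J ⥤ C} {c c' : Cone d} (i : c ≅ c') :
    c.pt ≅ c'.pt where
  hom := i.hom.hom
  inv := i.inv.hom
  hom_inv_id := by rw [← Cone.category_comp_hom, i.hom_inv_id]; rfl
  inv_hom_id := by rw [← Cone.category_comp_hom, i.inv_hom_id]; rfl

/-- The isomorphism of apices underlying an isomorphism of cocones. -/
def coconeApexIso {J : Type u} [SmallCategory J] {d : J ⥤ C} {c c' : Cocone d} (i : c ≅ c') :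
    c.pt ≅ c'.pt where
  hom := i.hom.hom
  inv := i.inv.hom
  hom_inv_id := by rw [← Cocone.category_comp_hom, i.hom_inv_id]; rfl
  inv_hom_id := by rw [← Cocone.category_comp_hom, i.inv_hom_id]; rfl

theorem PreservesConeClass.id (A : Set (DiagramCone C)) : PreservesConeClass (𝟭 C) A A :=
  fun _ _ d c hc => ⟨d, c, d.rightUnitor, hc, ⟨Cone.ext (Iso.refl _)⟩⟩

theorem PreservesCoconeClass.id (A : Set (DiagramCocone C)) : PreservesCoconeClass (𝟭 C) A A :=
  fun _ _ d c hc => ⟨d, c, d.rightUnitor.symm, hc, ⟨Cocone.ext (Iso.refl _)⟩⟩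

theorem PreservesConeClass.comp {F : C ⥤ D} {G : D ⥤ E} {A : Set (DiagramCone C)}
    {B : Set (DiagramCone D)} {K : Set (DiagramCone E)}
    (hF : PreservesConeClass F A B) (hG : PreservesConeClass G B K) :
    PreservesConeClass (F ⋙ G) A K := by
  intro J _ d c hc
  obtain ⟨d₁, c₁, e₁, h₁, ⟨i₁⟩⟩ := hF J d c hc
  obtain ⟨d₂, c₂, e₂, h₂, ⟨i₂⟩⟩ := hG J d₁ c₁ h₁
  refine ⟨d₂, c₂, Functor.isoWhiskerRight e₁ G ≪≫ e₂, h₂, ⟨Cone.ext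
    (G.mapIso (coneApexIso i₁) ≪≫ coneApexIso i₂) fun j => ?_⟩⟩
  have w₁ := i₁.hom.w j
  have w₂ := i₂.hom.w j
  dsimp [coneApexIso] at w₁ w₂ ⊢
  rw [Category.assoc, w₂, ← G.map_comp_assoc, ← G.map_comp_assoc, w₁]

theorem PreservesCoconeClass.comp {F : C ⥤ D} {G : D ⥤ E} {A : Set (DiagramCocone C)}
    {B : Set (DiagramCocone D)} {K : Set (DiagramCocone E)}
    (hF : PreservesCoconeClass F A B) (hG : PreservesCoconeClass G B K) :
    PreservesCoconeClass (F ⋙ G) A K := by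
  intro J _ d c hc
  obtain ⟨d₁, c₁, e₁, h₁, ⟨i₁⟩⟩ := hF J d c hc
  obtain ⟨d₂, c₂, e₂, h₂, ⟨i₂⟩⟩ := hG J d₁ c₁ h₁
  refine ⟨d₂, c₂, e₂ ≪≫ Functor.isoWhiskerRight e₁ G, h₂, ⟨Cocone.ext
    (G.mapIso (coconeApexIso i₁) ≪≫ coconeApexIso i₂) fun j => ?_⟩⟩
  have w₁ := i₁.hom.w j
  have w₂ := i₂.hom.w j
  dsimp [coconeApexIso] at w₁ w₂ ⊢
  rw [← w₂, ← w₁, G.map_comp, G.map_comp]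
  simp only [Category.assoc]

end

/-! ### The 2-category of sketches -/

namespace Sketch

/-- Morphisms of sketches. -/
@[ext]
structure Hom (S T : Sketch.{v, u}) where
  functor : S.carrier ⥤ T.carrier
  preservesCones : PreservesConeClass functor S.cones T.cones
  preservesCocones : PreservesCoconeClass functor S.cocones T.cocones

instance : CategoryStruct Sketch.{v, u} where
  Hom S T := Hom S T
  id _ := ⟨𝟭 _, .id _, .id _⟩
  comp F G := ⟨F.functor ⋙ G.functor, F.preservesCones.comp G.preservesCones,
    F.preservesCocones.comp G.preservesCocones⟩

/-- A 2-cell between morphisms of sketches: an arbitrary natural transformation. -/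
@[ext]
structure Hom₂ {S T : Sketch.{v, u}} (F G : S ⟶ T) where
  natTrans : F.functor ⟶ G.functor

instance {S T : Sketch.{v, u}} : Category (S ⟶ T) where
  Hom F G := Hom₂ F G
  id F := ⟨𝟙 F.functor⟩
  comp α β := ⟨α.natTrans ≫ β.natTrans⟩
  id_comp α := Hom₂.ext (Category.id_comp α.natTrans)
  comp_id α := Hom₂.ext (Category.comp_id α.natTrans)
  assoc α β γ := Hom₂.ext (Category.assoc α.natTrans β.natTrans γ.natTrans)

@[ext]
theorem hom₂_ext {S T : Sketch.{v, u}} {F G : S ⟶ T} {α β : F ⟶ G}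
    (h : ∀ X, α.natTrans.app X = β.natTrans.app X) : α = β :=
  Hom₂.ext (NatTrans.ext (funext h))

/-- An invertible 2-cell from a natural isomorphism. -/
def isoMk {S T : Sketch.{v, u}} {F G : S ⟶ T} (e : F.functor ≅ G.functor) : F ≅ G where
  hom := Hom₂.mk e.hom
  inv := Hom₂.mk e.inv
  hom_inv_id := Hom₂.ext e.hom_inv_id
  inv_hom_id := Hom₂.ext e.inv_hom_id

section
variable {S T U : Sketch.{v, u}}

@[simp] theorem id_functor : (𝟙 S : S ⟶ S).functor = 𝟭 S.carrier := rfl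
@[simp] theorem comp_functor (F : S ⟶ T) (G : T ⟶ U) :
    (F ≫ G).functor = F.functor ⋙ G.functor := rfl
@[simp] theorem id_natTrans (F : S ⟶ T) : Hom₂.natTrans (𝟙 F) = 𝟙 F.functor := rfl
@[simp] theorem comp_natTrans {F G H : S ⟶ T} (α : F ⟶ G) (β : G ⟶ H) :
    Hom₂.natTrans (α ≫ β) = Hom₂.natTrans α ≫ Hom₂.natTrans β := rfl
@[simp] theorem isoMk_hom {F G : S ⟶ T} (e : F.functor ≅ G.functor) :
    Hom₂.natTrans (isoMk e).hom = e.hom := rfl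
@[simp] theorem isoMk_inv {F G : S ⟶ T} (e : F.functor ≅ G.functor) :
    Hom₂.natTrans (isoMk e).inv = e.inv := rfl

end

instance : Bicategory Sketch.{v, u} where
  homCategory := inferInstance
  whiskerLeft F _ _ η := Hom₂.mk (Functor.whiskerLeft F.functor η.natTrans)
  whiskerRight η H := Hom₂.mk (Functor.whiskerRight η.natTrans H.functor)
  associator F G H := isoMk (Functor.associator F.functor G.functor H.functor)
  leftUnitor F := isoMk F.functor.leftUnitor
  rightUnitor F := isoMk F.functor.rightUnitor

instance : Bicategory.Strict Sketch.{v, u} where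
  leftUnitor_eqToIso _ := rfl
  rightUnitor_eqToIso _ := rfl
  associator_eqToIso _ _ _ := rfl

end Sketch

/-- The 2-category of small sketches: the full sub-2-category of `Sketch` on the sketches whose
underlying category is essentially small. -/
abbrev SmallSketch : Type (max (v + 1) (u + 2)) :=
  InducedBicategory Sketch.{v, u}
    (Subtype.val : {S : Sketch.{v, u} // EssentiallySmall.{u} S.carrier} → Sketch.{v, u})

/-! ### The left classifier and rounded sketches -/

namespace Sketch

variable (S : Sketch.{v, u})

/-- For a specified cocone `d ⟶ s`, the comparison map `colim (y d) ⟶ y s` of presheaves. -/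
noncomputable def comparison (δ : DiagramCocone S.carrier) :
    colimit (δ.diagram ⋙ yoneda) ⟶ yoneda.obj δ.cocone.pt :=
  colimit.desc (δ.diagram ⋙ yoneda) (yoneda.mapCocone δ.cocone)

/-- The class of all comparison maps of the specified cocones. -/
inductive comparisonMaps : MorphismProperty (S.carrierᵒᵖ ⥤ Type u)
  | mk (δ : DiagramCocone S.carrier) (hδ : δ ∈ S.cocones) : comparisonMaps (S.comparison δ)

/-- The underlying category of the left classifier of `S`: the full subcategory of the
presheaves on `S` that are orthogonal to all comparison maps. -/
abbrev Classifier : Type _ := S.comparisonMaps.isLocal.FullSubcategory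

/-- The inclusion of the classifier in presheaves. -/
abbrev classifierι : S.Classifier ⥤ (S.carrierᵒᵖ ⥤ Type u) := S.comparisonMaps.isLocal.ι

/-- The functor `J = L ∘ y` from `S` to its classifier, where `L` is the reflector, i.e. the
left adjoint of the inclusion. Since a sketch may have a proper class of specified cocones, `L`
is only required to be defined on the representable presheaves. -/
noncomputable def toClassifier
    (h : ∀ s : S.carrier, S.classifierι.leftAdjointObjIsDefined (yoneda.obj s)) :
    S.carrier ⥤ S.Classifier :=
  ObjectProperty.lift _ yoneda h ⋙ S.classifierι.partialLeftAdjoint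

/-- `S` is (left) rounded: `J` sends the specified cones to limit cones. -/
def IsRounded : Prop :=
  ∃ h : ∀ s : S.carrier, S.classifierι.leftAdjointObjIsDefined (yoneda.obj s),
    ∀ π ∈ S.cones, Nonempty (IsLimit ((S.toClassifier h).mapCone π.cone))

/-- Whenever the whole reflector `L` exists, rounded means that `L ∘ y` sends the specified
cones to limit cones. -/
theorem isRounded_iff (L : (S.carrierᵒᵖ ⥤ Type u) ⥤ S.Classifier) (adj : L ⊣ S.classifierι) :
    S.IsRounded ↔ ∀ π ∈ S.cones, Nonempty (IsLimit ((yoneda ⋙ L).mapCone π.cone)) := by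
  have h : ∀ s : S.carrier, S.classifierι.leftAdjointObjIsDefined (yoneda.obj s) :=
    fun s => Functor.leftAdjointObjIsDefined_of_adjunction adj _
  have inst (s : S.carrier) :
      (S.classifierι ⋙ coyoneda.obj (op (yoneda.obj s))).IsCorepresentable := h s
  let X (s : S.carrier) : S.classifierι.PartialLeftAdjointSource := ⟨yoneda.obj s, h s⟩
  have key (s : S.carrier) : S.classifierι.partialLeftAdjointHomEquiv (X := X s)
      ((S.classifierι ⋙ coyoneda.obj (op (yoneda.obj s))).corepresentableBy.uniqueUpToIso
        (adj.corepresentableBy (yoneda.obj s))).hom = adj.unit.app (yoneda.obj s) := by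
    refine Eq.trans ?_ (adj.homEquiv_id _)
    exact Equiv.apply_symm_apply
      (S.classifierι ⋙ coyoneda.obj (op (yoneda.obj s))).corepresentableBy.homEquiv
      (adj.homEquiv (yoneda.obj s) _ (𝟙 _))
  let e : S.toClassifier h ≅ yoneda ⋙ L := NatIso.ofComponents
    (fun s => (S.classifierι ⋙ coyoneda.obj (op (yoneda.obj s))).corepresentableBy.uniqueUpToIso
      (adj.corepresentableBy (yoneda.obj s)))
    (fun {s t} f => by
      apply (S.classifierι.partialLeftAdjointHomEquiv (X := X s)).injective
      refine (Functor.partialLeftAdjointHomEquiv_map_comp _ _ _).trans ?_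
      refine Eq.trans ?_ (Functor.partialLeftAdjointHomEquiv_comp _ _ _).symm
      rw [key, key]
      exact adj.unit.naturality (yoneda.map f))
  constructor
  · rintro ⟨_, H⟩ π hπ
    exact ⟨IsLimit.mapConeEquiv e (H π hπ).some⟩
  · intro H
    exact ⟨h, fun π hπ => ⟨IsLimit.mapConeEquiv e.symm (H π hπ).some⟩⟩

end Sketch

/-- The 2-category of small rounded sketches: the full sub-2-category of `SmallSketch` on the
rounded sketches. -/
abbrev RoundedSketch : Type (max (v + 1) (u + 2)) :=
  InducedBicategory SmallSketch.{v, u}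
    (Subtype.val : {S : SmallSketch.{v, u} // S.val.IsRounded} → SmallSketch.{v, u})

/-! ### Lex-weights and exact categories -/

/-- A lex-weight: a presheaf of sets on a small finitely complete category. -/
structure LexWeight : Type (u + 1) where
  K : Type u
  [cat : SmallCategory K]
  [hasFiniteLimits : HasFiniteLimits K]
  weight : Kᵒᵖ ⥤ Type u

attribute [instance] LexWeight.cat LexWeight.hasFiniteLimits

namespace LexWeight

/-- The category `El φ` of pairs `(k, x ∈ φ k)`; a morphism `(k, x) ⟶ (k', x')` is `f : k ⟶ k'`
with `φ f x' = x`. -/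
abbrev El (φ : LexWeight.{u}) : Type u := φ.weight.Elementsᵒᵖ

/-- The projection `El φ ⥤ K`. The weighted colimit of `D : K ⥤ C` by `φ` is the colimit of
`φ.proj ⋙ D`. -/
abbrev proj (φ : LexWeight.{u}) : φ.El ⥤ φ.K := (CategoryOfElements.π φ.weight).leftOp

end LexWeight

section
variable (Φ : Set LexWeight.{u}) (C : Type v) [Category.{u} C]

/-- `Φ_l C`: the presheaves in the smallest replete full subcategory of all presheaves on `C` that
contains the representables and is closed under finite limits and under `Φ`-lex-colimits, i.e.
colimits weighted by some `φ ∈ Φ` of finite-limit-preserving functors. -/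
inductive phiClosure : ObjectProperty (Cᵒᵖ ⥤ Type u)
  | representable (c : C) : phiClosure (yoneda.obj c)
  | finiteLimit (J : Type u) [SmallCategory J] [FinCategory J] (d : J ⥤ Cᵒᵖ ⥤ Type u)
      (hd : ∀ j, phiClosure (d.obj j)) (c : Cone d) (hc : IsLimit c) : phiClosure c.pt
  | lexColimit (φ : LexWeight.{u}) (hφ : φ ∈ Φ) (D : φ.K ⥤ Cᵒᵖ ⥤ Type u)
      (hlex : PreservesFiniteLimits D) (hD : ∀ k, phiClosure (D.obj k))
      (c : Cocone (φ.proj ⋙ D)) (hc : IsColimit c) : phiClosure c.pt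

/-- The corestricted Yoneda embedding of `C` in `Φ_l C`. -/
def phiYoneda : C ⥤ (phiClosure Φ C).FullSubcategory :=
  ObjectProperty.lift _ yoneda phiClosure.representable

/-- `C` is `Φ`-exact: it is finitely complete, and its embedding in `Φ_l C` has a left adjoint
which preserves finite limits. -/
structure IsPhiExact : Prop where
  hasFiniteLimits : HasFiniteLimits C
  exists_lex_leftAdjoint : ∃ L : (phiClosure Φ C).FullSubcategory ⥤ C,
    Nonempty (L ⊣ phiYoneda Φ C) ∧ PreservesFiniteLimits L

/-- All colimit cocones specified by `Φ`: the colimit cocones under a composite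
`El φ ⥤ K ⥤ C` with `φ ∈ Φ` and `K ⥤ C` preserving finite limits. -/
inductive phiCocones : Set (DiagramCocone C)
  | mk (φ : LexWeight.{u}) (hφ : φ ∈ Φ) (D : φ.K ⥤ C) (hlex : PreservesFiniteLimits D)
      (c : Cocone (φ.proj ⋙ D)) (hc : IsColimit c) :
      phiCocones (DiagramCocone.mk φ.El (φ.proj ⋙ D) c)

/-- All limit cones over finite diagrams. -/
def finiteLimitCones : Set (DiagramCone C) :=
  {π | Nonempty (FinCategory π.J) ∧ Nonempty (IsLimit π.cone)}

/-- All limit cones over small diagrams. -/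
def smallLimitCones : Set (DiagramCone C) :=
  {π | Nonempty (IsLimit π.cone)}

end

/-- A small `Φ`-exact category. -/
structure PhiEx (Φ : Set LexWeight.{u}) : Type (max (v + 1) (u + 1)) where
  carrier : Type v
  [cat : Category.{u} carrier]
  essentiallySmall : EssentiallySmall.{u} carrier
  isPhiExact : IsPhiExact Φ carrier

attribute [instance] PhiEx.cat

namespace PhiEx

variable {Φ : Set LexWeight.{u}}

/-- Morphisms of `Φ`-exact categories: the functors preserving finite limits and the colimits
specified by `Φ`. -/
@[ext]
structure Hom (S T : PhiEx.{v, u} Φ) where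
  functor : S.carrier ⥤ T.carrier
  preservesFiniteLimits : PreservesFiniteLimits functor
  preservesPhiColimits : ∀ φ ∈ Φ, ∀ D : φ.K ⥤ S.carrier, PreservesFiniteLimits D →
    PreservesColimit (φ.proj ⋙ D) functor

instance : CategoryStruct (PhiEx.{v, u} Φ) where
  Hom S T := Hom S T
  id _ := ⟨𝟭 _, inferInstance, fun _ _ _ _ => inferInstance⟩
  comp F G := ⟨F.functor ⋙ G.functor,
    have := F.preservesFiniteLimits
    have := G.preservesFiniteLimits
    comp_preservesFiniteLimits _ _,
    fun φ hφ D hD =>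
      have := F.preservesFiniteLimits
      have := F.preservesPhiColimits φ hφ D hD
      have : PreservesColimit ((φ.proj ⋙ D) ⋙ F.functor) G.functor :=
        G.preservesPhiColimits φ hφ (D ⋙ F.functor) (comp_preservesFiniteLimits _ _)
      comp_preservesColimit _ _⟩

/-- A 2-cell between morphisms of `Φ`-exact categories: an arbitrary natural transformation. -/
@[ext]
structure Hom₂ {S T : PhiEx.{v, u} Φ} (F G : S ⟶ T) where
  natTrans : F.functor ⟶ G.functor

instance {S T : PhiEx.{v, u} Φ} : Category (S ⟶ T) where
  Hom F G := Hom₂ F G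
  id F := ⟨𝟙 F.functor⟩
  comp α β := ⟨α.natTrans ≫ β.natTrans⟩
  id_comp α := Hom₂.ext (Category.id_comp α.natTrans)
  comp_id α := Hom₂.ext (Category.comp_id α.natTrans)
  assoc α β γ := Hom₂.ext (Category.assoc α.natTrans β.natTrans γ.natTrans)

@[ext]
theorem hom₂_ext {S T : PhiEx.{v, u} Φ} {F G : S ⟶ T} {α β : F ⟶ G}
    (h : ∀ X, α.natTrans.app X = β.natTrans.app X) : α = β :=
  Hom₂.ext (NatTrans.ext (funext h))

/-- An invertible 2-cell from a natural isomorphism. -/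
def isoMk {S T : PhiEx.{v, u} Φ} {F G : S ⟶ T} (e : F.functor ≅ G.functor) : F ≅ G where
  hom := Hom₂.mk e.hom
  inv := Hom₂.mk e.inv
  hom_inv_id := Hom₂.ext e.hom_inv_id
  inv_hom_id := Hom₂.ext e.inv_hom_id

section
variable {S T U : PhiEx.{v, u} Φ}

@[simp] theorem id_functor : (𝟙 S : S ⟶ S).functor = 𝟭 S.carrier := rfl
@[simp] theorem comp_functor (F : S ⟶ T) (G : T ⟶ U) :
    (F ≫ G).functor = F.functor ⋙ G.functor := rfl
@[simp] theorem id_natTrans (F : S ⟶ T) : Hom₂.natTrans (𝟙 F) = 𝟙 F.functor := rfl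
@[simp] theorem comp_natTrans {F G H : S ⟶ T} (α : F ⟶ G) (β : G ⟶ H) :
    Hom₂.natTrans (α ≫ β) = Hom₂.natTrans α ≫ Hom₂.natTrans β := rfl
@[simp] theorem isoMk_hom {F G : S ⟶ T} (e : F.functor ≅ G.functor) :
    Hom₂.natTrans (isoMk e).hom = e.hom := rfl
@[simp] theorem isoMk_inv {F G : S ⟶ T} (e : F.functor ≅ G.functor) :
    Hom₂.natTrans (isoMk e).inv = e.inv := rfl

end

instance : Bicategory (PhiEx.{v, u} Φ) where
  homCategory := inferInstance
  whiskerLeft F _ _ η := Hom₂.mk (Functor.whiskerLeft F.functor η.natTrans)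
  whiskerRight η H := Hom₂.mk (Functor.whiskerRight η.natTrans H.functor)
  associator F G H := isoMk (Functor.associator F.functor G.functor H.functor)
  leftUnitor F := isoMk F.functor.leftUnitor
  rightUnitor F := isoMk F.functor.rightUnitor

instance : Bicategory.Strict (PhiEx.{v, u} Φ) where
  leftUnitor_eqToIso _ := rfl
  rightUnitor_eqToIso _ := rfl
  associator_eqToIso _ _ _ := rfl

/-- The sketch on `C` with all finite limit cones and all colimit cocones specified by `Φ`. -/
def sketch (C : PhiEx.{v, u} Φ) : Sketch.{v, u} where
  carrier := C.carrier
  cones := finiteLimitCones C.carrier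
  cocones := phiCocones Φ C.carrier

/-- The sketch on `C` with all small limit cones and all colimit cocones specified by `Φ`. -/
def sketchAllLimits (C : PhiEx.{v, u} Φ) : Sketch.{v, u} where
  carrier := C.carrier
  cones := smallLimitCones C.carrier
  cocones := phiCocones Φ C.carrier

/-- The sketch of `C`, as an object of the 2-category of small sketches. -/
def smallSketch (C : PhiEx.{v, u} Φ) : SmallSketch.{v, u} := ⟨C.sketch, C.essentiallySmall⟩

/-- A morphism of `Φ`-exact categories is a morphism of sketches. -/
def sketchHom {C D : PhiEx.{v, u} Φ} (F : C ⟶ D) : C.sketch ⟶ D.sketch where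
  functor := F.functor
  preservesCones := by
    rintro J _ (d : J ⥤ C.carrier) c ⟨⟨hJ⟩, ⟨hc⟩⟩
    have : FinCategory J := hJ
    have := F.preservesFiniteLimits
    have : PreservesLimit d F.functor := inferInstance
    exact ⟨d ⋙ F.functor, F.functor.mapCone c, Iso.refl _,
      ⟨⟨hJ⟩, ⟨isLimitOfPreserves F.functor hc⟩⟩, ⟨Cone.ext (Iso.refl _)⟩⟩
  preservesCocones := by
    rintro J _ d c ⟨φ, hφ, D, hlex, c, hc⟩
    have := F.preservesFiniteLimits
    have := F.preservesPhiColimits φ hφ D hlex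
    exact ⟨(φ.proj ⋙ D) ⋙ F.functor, F.functor.mapCocone c, Iso.refl _,
      phiCocones.mk φ hφ (D ⋙ F.functor) (comp_preservesFiniteLimits _ _) _
        (isColimitOfPreserves F.functor hc), ⟨Cocone.ext (Iso.refl _)⟩⟩

/-- The 2-functor from small `Φ`-exact categories to small sketches. -/
def toSketch (Φ : Set LexWeight.{u}) : StrictPseudofunctor (PhiEx.{v, u} Φ) SmallSketch.{v, u} :=
  StrictPseudofunctor.mk'' {
    obj C := C.smallSketch
    map {C D} F := (InducedBicategory.mkHom (sketchHom F) : C.smallSketch ⟶ D.smallSketch)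
    map₂ α := InducedBicategory.mkHom₂ (Sketch.Hom₂.mk α.natTrans)
    map₂_whisker_left _ _ _ _ := ((Category.id_comp _).trans (Category.comp_id _)).symm
    map₂_whisker_right _ _ := ((Category.id_comp _).trans (Category.comp_id _)).symm }

end PhiEx

/-!
The factorization through rounded sketches rests on subcanonicity. A representable presheaf
`Hom(-, s)` sends every colimit cocone to a limit cone, so if all specified cocones of a sketch
are colimit cocones, then every representable is orthogonal to all comparison maps
(`Sketch.isLocal_yoneda`). Hence the reflector is defined on representables and does not change
them, so that `J` followed by the inclusion in presheaves is the Yoneda embedding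
(`Sketch.toClassifierCompιIso`). The Yoneda embedding preserves all limits and the fully faithful
inclusion reflects them, so `J` sends every limit cone to a limit cone, whatever its size
(`Sketch.isRounded_of_isColimit`). Since the inclusion of rounded sketches is full on 1-cells and
2-cells, this condition on objects is all that a factorization of the 2-functor requires.

For the reflector on all presheaves, the category of presheaves on an essentially small category
is locally presentable, and in a locally presentable category the objects orthogonal to a *set*
of maps form a reflective subcategory (`MorphismProperty.isRightAdjoint_ι_isLocal_of_isSmall`).
The comparison maps form a proper class only because of isomorphic copies: up to isomorphism of
arrows, a comparison map depends only on `φ ∈ Φ` and on the isomorphism class of the diagram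
`D : φ.K ⥤ C`, and these data form a set when `Φ` does (`PhiEx.comparisonMaps_le_isoClosure`).
-/

/-! ### Reflectivity of orthogonality classes -/

section

universe w v₁ u₁

/-- A single regular cardinal bounds the presentability ranks of a small family of objects. -/
theorem exists_cardinal_forall_isCardinalPresentable {C : Type u₁} [Category.{v₁} C] {ι : Type w}
    (X : ι → C) [∀ i, IsPresentable.{w} (X i)] :
    ∃ (κ : Cardinal.{w}) (_ : Fact κ.IsRegular), ∀ i, IsCardinalPresentable (X i) κ := by
  choose κ hκ h using fun i => Functor.IsAccessible.exists_cardinal (F := coyoneda.obj (op (X i)))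
  obtain ⟨κ', hκ', h'⟩ := HasCardinalLT.exists_regular_cardinal_forall.{w}
    (fun i => (κ i).ord.ToType)
  have : Fact κ'.IsRegular := ⟨hκ'⟩
  refine ⟨κ', inferInstance, fun i => ?_⟩
  have : IsCardinalPresentable (X i) (κ i) := h i
  refine isCardinalPresentable_of_le (κ := κ i) (X i) ?_
  simpa [hasCardinalLT_iff_cardinal_mk_lt] using (h' i).le

/-- In a locally presentable category, the objects orthogonal to a set of morphisms form a
reflective subcategory. -/
theorem CategoryTheory.MorphismProperty.isRightAdjoint_ι_isLocal_of_isSmall {C : Type u₁}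
    [Category.{v₁} C] [IsLocallyPresentable.{w} C] (W : MorphismProperty C)
    [MorphismProperty.IsSmall.{w} W] : W.isLocal.ι.IsRightAdjoint := by
  obtain ⟨κ₀, _, _⟩ := IsLocallyPresentable.exists_cardinal.{w} C
  have : LocallySmall.{w} C := HasCardinalFilteredGenerator.toLocallySmall (κ := κ₀)
  have : HasColimitsOfSize.{w, w} C := IsCardinalLocallyPresentable.toHasColimitsOfSize κ₀
  obtain ⟨ι, A, B, f, rfl⟩ := (MorphismProperty.isSmall_iff_eq_ofHoms.{w} W).1 inferInstance
  obtain ⟨κ, _, hκ⟩ := exists_cardinal_forall_isCardinalPresentable.{w} (Sum.elim A B)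
  refine MorphismProperty.isRightAdjoint_ι_isLocal _ κ ?_
  rintro _ _ _ ⟨i⟩
  exact ⟨hκ (.inl i), hκ (.inr i)⟩

/-- Orthogonality to a class of morphisms only depends on the morphisms up to isomorphism. -/
theorem CategoryTheory.MorphismProperty.isLocal_eq_of_le_isoClosure {C : Type u₁}
    [Category.{v₁} C] {W W' : MorphismProperty C} (h : W' ≤ W) (h' : W ≤ W'.isoClosure) :
    W.isLocal = W'.isLocal :=
  le_antisymm (MorphismProperty.isLocal_antitone h)
    ((ObjectProperty.le_isLocal_iff _ _).1 (h'.trans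
      ((MorphismProperty.isoClosure_le_iff _ _).2
        ((ObjectProperty.le_isLocal_iff _ _).2 le_rfl))))

end

/-- Presheaves on an essentially small category form a locally presentable category. -/
theorem isLocallyPresentable_presheaf_of_essentiallySmall (C : Type v) [Category.{u} C]
    [EssentiallySmall.{u} C] : IsLocallyPresentable.{u} (Cᵒᵖ ⥤ Type u) :=
  (equivSmallModel.{u} C).op.congrLeft.symm.isLocallyPresentable

/-! ### Sketches whose specified cocones are colimit cocones -/

namespace Sketch

variable (S : Sketch.{v, u})

/-- Subcanonicity: representables turn colimit cocones into limit cones, which is orthogonality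
to the comparison maps. -/
theorem isLocal_yoneda (hS : ∀ δ ∈ S.cocones, Nonempty (IsColimit δ.cocone)) (s : S.carrier) :
    S.comparisonMaps.isLocal (yoneda.obj s) := by
  rintro _ _ _ ⟨δ, hδ⟩
  obtain ⟨hc⟩ := hS δ hδ
  have fac (j : δ.J) : colimit.ι (δ.diagram ⋙ yoneda) j ≫ S.comparison δ =
      yoneda.map (δ.cocone.ι.app j) := colimit.ι_desc _ _
  constructor
  · intro g₁ g₂ h
    obtain ⟨g₁, rfl⟩ := yoneda.map_surjective g₁
    obtain ⟨g₂, rfl⟩ := yoneda.map_surjective g₂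
    congr 1
    refine hc.hom_ext fun j => yoneda.map_injective ?_
    rw [Functor.map_comp, Functor.map_comp, ← fac, Category.assoc, Category.assoc]
    exact congrArg (colimit.ι (δ.diagram ⋙ yoneda) j ≫ ·) h
  · intro g
    choose t ht using fun j =>
      yoneda.map_surjective (colimit.ι (δ.diagram ⋙ yoneda) j ≫ g)
    let c : Cocone δ.diagram := Cocone.mk s
      { app := t
        naturality := fun i j f => yoneda.map_injective (by
          have := colimit.w_assoc (δ.diagram ⋙ yoneda) f g
          rw [← ht, ← ht] at this
          simpa using this) }
    refine ⟨yoneda.map (hc.desc c), colimit.hom_ext fun j => ?_⟩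
    dsimp only
    rw [← Category.assoc, fac, ← Functor.map_comp, hc.fac, ht]

variable {S}

/-- An object of the classifier is its own reflection. -/
theorem leftAdjointObjIsDefined_of_isLocal {P : S.carrierᵒᵖ ⥤ Type u}
    (hP : S.comparisonMaps.isLocal P) : S.classifierι.leftAdjointObjIsDefined P :=
  Functor.CorepresentableBy.isCorepresentable (X := (⟨P, hP⟩ : S.Classifier))
    { homEquiv := (ObjectProperty.fullyFaithfulι _).homEquiv
      homEquiv_comp := fun _ _ => rfl }

/-- When representables belong to the classifier, the reflector leaves them unchanged: the units
`y s ⟶ J s` are invertible. -/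
noncomputable def toClassifierCompιIso
    (h : ∀ s : S.carrier, S.classifierι.leftAdjointObjIsDefined (yoneda.obj s))
    (hS : ∀ s : S.carrier, S.comparisonMaps.isLocal (yoneda.obj s)) :
    yoneda ≅ S.toClassifier h ⋙ S.classifierι :=
  let X (s : S.carrier) : S.classifierι.PartialLeftAdjointSource := ⟨yoneda.obj s, h s⟩
  let Y (s : S.carrier) : S.Classifier := ⟨yoneda.obj s, hS s⟩
  let unit (s : S.carrier) :
      yoneda.obj s ⟶ S.classifierι.obj (S.classifierι.partialLeftAdjointObj (X s)) :=
    S.classifierι.partialLeftAdjointHomEquiv (X := X s) (𝟙 _)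
  let retraction (s : S.carrier) : S.classifierι.partialLeftAdjointObj (X s) ⟶ Y s :=
    S.classifierι.partialLeftAdjointHomEquiv.symm (𝟙 (yoneda.obj s))
  have hom_inv (s : S.carrier) : unit s ≫ S.classifierι.map (retraction s) = 𝟙 _ := by
    refine (Functor.partialLeftAdjointHomEquiv_comp _ _ _).symm.trans ?_
    rw [Category.id_comp]
    exact Equiv.apply_symm_apply _ _
  NatIso.ofComponents
    (fun s =>
      { hom := unit s
        inv := S.classifierι.map (retraction s)
        hom_inv_id := hom_inv s
        inv_hom_id := by
          -- `unit s` is a morphism of the full subcategory `S.Classifier`, where the universal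
          -- property of the reflection applies
          obtain ⟨r, hr⟩ : ∃ r : Y s ⟶ S.classifierι.partialLeftAdjointObj (X s),
            S.classifierι.map r = unit s := ⟨ObjectProperty.homMk (unit s), rfl⟩
          have key : retraction s ≫ r = 𝟙 _ := by
            apply S.classifierι.partialLeftAdjointHomEquiv.injective
            rw [Functor.partialLeftAdjointHomEquiv_comp, hr]
            refine (congrArg (· ≫ unit s) (Equiv.apply_symm_apply _ _)).trans ?_
            exact Category.id_comp _
          rw [← hr]
          exact (S.classifierι.map_comp _ _).symm.trans
            ((congrArg _ key).trans (S.classifierι.map_id _)) })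
    (fun {s t} f => by
      refine (Functor.partialLeftAdjointHomEquiv_map S.classifierι
        (X := X s) (Y := X t) (ObjectProperty.homMk (yoneda.map f))).symm.trans ?_
      refine Eq.trans ?_ (Functor.partialLeftAdjointHomEquiv_comp _ _ _)
      rw [Category.id_comp]
      rfl)

/-- A sketch whose specified cones and cocones are limit cones and colimit cocones is rounded. -/
theorem isRounded_of_isColimit (hS : ∀ δ ∈ S.cocones, Nonempty (IsColimit δ.cocone))
    (hS' : ∀ π ∈ S.cones, Nonempty (IsLimit π.cone)) : S.IsRounded := by
  have hloc := S.isLocal_yoneda hS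
  refine ⟨fun s => leftAdjointObjIsDefined_of_isLocal (hloc s), fun π hπ => ?_⟩
  obtain ⟨hc⟩ := hS' π hπ
  have : IsLimit (S.classifierι.mapCone ((S.toClassifier
      fun s => leftAdjointObjIsDefined_of_isLocal (hloc s)).mapCone π.cone)) :=
    IsLimit.mapConeEquiv (toClassifierCompιIso _ hloc) (isLimitOfPreserves yoneda hc)
  exact ⟨isLimitOfReflects S.classifierι this⟩

/-- Isomorphic colimit cocones have isomorphic comparison maps. -/
theorem nonempty_comparison_iso {J : Type u} [SmallCategory J] {d d' : J ⥤ S.carrier}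
    (e : d ≅ d') {c : Cocone d} {c' : Cocone d'} (hc : IsColimit c) (hc' : IsColimit c') :
    Nonempty (Arrow.mk (S.comparison ⟨J, d, c⟩) ≅ Arrow.mk (S.comparison ⟨J, d', c'⟩)) := by
  refine ⟨Arrow.isoMk (HasColimit.isoOfNatIso (Functor.isoWhiskerRight e yoneda))
    (yoneda.mapIso (hc.coconePointsIsoOfNatIso hc' e)) (colimit.hom_ext fun j => ?_)⟩
  have h₁ : colimit.ι (d ⋙ yoneda) j ≫ S.comparison ⟨J, d, c⟩ = yoneda.map (c.ι.app j) :=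
    colimit.ι_desc _ _
  have h₂ : colimit.ι (d' ⋙ yoneda) j ≫ S.comparison ⟨J, d', c'⟩ = yoneda.map (c'.ι.app j) :=
    colimit.ι_desc _ _
  have h₃ := HasColimit.isoOfNatIso_ι_hom_assoc (Functor.isoWhiskerRight e yoneda) j
    (S.comparison ⟨J, d', c'⟩)
  refine h₃.trans ?_
  rw [h₂]
  refine Eq.trans ?_ ((congrArg (· ≫ yoneda.map (hc.coconePointsIsoOfNatIso hc' e).hom)
    h₁.symm).trans (Category.assoc _ _ _))
  refine (yoneda.map_comp _ _).symm.trans (Eq.trans ?_ (yoneda.map_comp _ _))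
  congr 1
  exact (hc.comp_coconePointsIsoOfNatIso_hom hc' e j).symm

end Sketch

/-! ### Extensionality of strict pseudofunctors -/

/-- The coherence isomorphisms of a strict pseudofunctor are determined by its action on cells. -/
theorem CategoryTheory.StrictPseudofunctor.ext_of_toPrelaxFunctor {B C : Type*} [Bicategory B]
    [Bicategory C] {F G : StrictPseudofunctor B C}
    (h : F.toPrelaxFunctor = G.toPrelaxFunctor) : F = G := by
  obtain ⟨⟨⟨F, mapId, mapComp, _, _, _, _, _⟩, _, mapId_eq⟩, _, mapComp_eq⟩ := F
  obtain ⟨⟨⟨G, mapId', mapComp', _, _, _, _, _⟩, _, mapId_eq'⟩, _, mapComp_eq'⟩ := G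
  obtain rfl : F = G := h
  obtain rfl : mapId = mapId' := funext fun _ => (mapId_eq _).trans (mapId_eq' _).symm
  obtain rfl : @mapComp = @mapComp' := by
    funext a b c f g
    exact (mapComp_eq f g).trans (mapComp_eq' f g).symm
  rfl

/-! ### The sketch of a `Φ`-exact category -/

namespace PhiEx

variable {Φ : Set LexWeight.{u}} (C : PhiEx.{v, u} Φ)

theorem isColimit_of_mem_phiCocones (δ : DiagramCocone C.carrier)
    (hδ : δ ∈ phiCocones Φ C.carrier) : Nonempty (IsColimit δ.cocone) := by
  obtain ⟨φ, hφ, D, hlex, c, hc⟩ := hδ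
  exact ⟨hc⟩

theorem isRounded_sketch : C.sketch.IsRounded :=
  Sketch.isRounded_of_isColimit C.isColimit_of_mem_phiCocones fun _ hπ => hπ.2

theorem isRounded_sketchAllLimits : C.sketchAllLimits.IsRounded :=
  Sketch.isRounded_of_isColimit C.isColimit_of_mem_phiCocones fun _ hπ => hπ

instance : EssentiallySmall.{u} C.carrier := C.essentiallySmall

/-- The data from which a specified cocone of `C.sketch` is determined up to isomorphism: a weight
`φ ∈ Φ` and a lex functor from `φ.K` to `C` of which the `φ`-weighted colimit exists. The functor
takes values in a small model of `C`, so that these data form a set when `Φ` does. -/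
structure CoconeIndex where
  φ : Φ
  D : φ.1.K ⥤ SmallModel.{u} C.carrier
  lex : PreservesFiniteLimits (D ⋙ (equivSmallModel.{u} C.carrier).inverse)
  hasColimit : HasColimit (φ.1.proj ⋙ D ⋙ (equivSmallModel.{u} C.carrier).inverse)

attribute [instance] CoconeIndex.hasColimit

instance [Small.{u} Φ] : Small.{u} C.CoconeIndex :=
  small_of_injective (β := Σ φ : Φ, φ.1.K ⥤ SmallModel.{u} C.carrier)
    (f := fun i => ⟨i.φ, i.D⟩) (by
      rintro ⟨φ, D, _, _⟩ ⟨φ', D', _, _⟩ h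
      cases h
      rfl)

variable {C} in
/-- The chosen colimit cocone on the given data. -/
noncomputable def CoconeIndex.diagramCocone (i : C.CoconeIndex) : DiagramCocone C.carrier where
  J := i.φ.1.El
  diagram := i.φ.1.proj ⋙ i.D ⋙ (equivSmallModel.{u} C.carrier).inverse
  cocone := colimit.cocone _

/-- The comparison maps of the chosen colimit cocones; they represent all comparison maps of
`C.sketch` up to isomorphism. -/
def chosenComparisonMaps : MorphismProperty (C.carrierᵒᵖ ⥤ Type u) :=
  MorphismProperty.ofHoms fun i : C.CoconeIndex => C.sketch.comparison i.diagramCocone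

instance [Small.{u} Φ] : MorphismProperty.IsSmall.{u} C.chosenComparisonMaps :=
  MorphismProperty.isSmall_ofHoms _

theorem chosenComparisonMaps_le : C.chosenComparisonMaps ≤ C.sketch.comparisonMaps := by
  rintro _ _ _ ⟨i⟩
  exact .mk _ (.mk i.φ.1 i.φ.2 _ i.lex _ (colimit.isColimit _))

theorem comparisonMaps_le_isoClosure :
    C.sketch.comparisonMaps ≤ C.chosenComparisonMaps.isoClosure := by
  rintro _ _ _ ⟨_, ⟨φ, hφ, D, hlex, c, hc⟩⟩
  let E := equivSmallModel.{u} C.carrier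
  let e : D ≅ (D ⋙ E.functor) ⋙ E.inverse :=
    D.rightUnitor.symm ≪≫ Functor.isoWhiskerLeft D E.unitIso ≪≫ (Functor.associator _ _ _).symm
  let e' := Functor.isoWhiskerLeft φ.proj e
  have : HasColimit (φ.proj ⋙ D) := ⟨⟨c, hc⟩⟩
  let i : C.CoconeIndex :=
    { φ := ⟨φ, hφ⟩
      D := D ⋙ E.functor
      lex := preservesFiniteLimits_of_natIso e
      hasColimit := hasColimit_of_iso e'.symm }
  obtain ⟨a⟩ := C.sketch.nonempty_comparison_iso e' hc
    (@colimit.isColimit _ _ _ _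
    (φ.proj ⋙ (D ⋙ E.functor) ⋙ E.inverse) i.hasColimit)
  exact ⟨_, _, _, MorphismProperty.ofHoms.mk i, ⟨a.symm⟩⟩

theorem isRightAdjoint_classifierι [Small.{u} Φ] : C.sketch.classifierι.IsRightAdjoint := by
  have := isLocallyPresentable_presheaf_of_essentiallySmall C.carrier
  have h := C.chosenComparisonMaps.isRightAdjoint_ι_isLocal_of_isSmall
  rwa [← MorphismProperty.isLocal_eq_of_le_isoClosure C.chosenComparisonMaps_le
    C.comparisonMaps_le_isoClosure] at h

/-- The sketch of `C`, as an object of the 2-category of small rounded sketches. -/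
def roundedSketch : RoundedSketch.{v, u} := ⟨C.smallSketch, C.isRounded_sketch⟩

/-- The 2-functor from `Φ`-exact categories to small sketches, with values in rounded sketches. -/
def toRoundedSketch (Φ : Set LexWeight.{u}) :
    StrictPseudofunctor (PhiEx.{v, u} Φ) RoundedSketch.{v, u} :=
  StrictPseudofunctor.mk'' {
    obj C := C.roundedSketch
    map {C D} F :=
      (InducedBicategory.mkHom ((toSketch Φ).map F) : C.roundedSketch ⟶ D.roundedSketch)
    map₂ α := InducedBicategory.mkHom₂ ((toSketch Φ).map₂ α)
    map₂_whisker_left _ _ _ _ := ((Category.id_comp _).trans (Category.comp_id _)).symm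
    map₂_whisker_right _ _ := ((Category.id_comp _).trans (Category.comp_id _)).symm }

theorem toRoundedSketch_comp_forget (Φ : Set LexWeight.{u}) :
    (toRoundedSketch.{v, u} Φ).comp InducedBicategory.forget = toSketch Φ :=
  StrictPseudofunctor.ext_of_toPrelaxFunctor rfl

end PhiEx

theorem mainTheorem9 (Φ : Set LexWeight.{u}) :
    -- the 2-functor to small sketches factors through the 2-category of rounded sketches
    (∃ I' : StrictPseudofunctor (PhiEx.{v, u} Φ) RoundedSketch.{v, u},
      I'.comp InducedBicategory.forget = PhiEx.toSketch Φ) ∧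
    -- the sketches stay rounded if all small limit cones are specified
    (∀ C : PhiEx.{v, u} Φ, C.sketchAllLimits.IsRounded) ∧
    -- if `Φ` is a set, then the reflector of the classifier is defined on all presheaves
    (Small.{u} Φ → ∀ C : PhiEx.{v, u} Φ, C.sketch.classifierι.IsRightAdjoint) :=
  ⟨⟨PhiEx.toRoundedSketch Φ, PhiEx.toRoundedSketch_comp_forget Φ⟩,
    fun C => C.isRounded_sketchAllLimits, fun _ C => C.isRightAdjoint_classifierι⟩
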